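/- Let $G$ be a finite simple graph of order $n>2$ with $m$ edges, and let $\mu_1(G)\ge\mu_2(G)\ge\cdots\ge\mu_n(G)=0$ be the eigenvalues, counted with multiplicity, of its Laplacian matrix $L(G)=D(G)-A(G)$, where $D(G)$ is the diagonal matrix of vertex degrees and $A(G)$ is the adjacency matrix. Write $K_{a,b}$ for the complete bipartite graph with parts of sizes $a$ and $b$, $\cup$ for the vertex-disjoint union of graphs, and $rK_1$ for the graph with $r$ vertices and no edges. Suppose that $G$ is not isomorphic to $K_{1,n-r-1}\cup rK_1$ for any integer $r$ with $0\le r\le\lceil n/2\rceil-2$ or $r=n-2$. Then $$\mu_2(G)\ge\frac{2m}{n}.$$ Moreover, equality holds if and only if $G\cong nK_1$, or $n$ is even and $G\cong K_{n/2,n/2}$, or $n$ is even and $G\cong K_{1,n/2}\cup(n/2-1)K_1$. -/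

import Mathlib

/-- The graph `K_{1,s} ∪ r K_1`: the vertex-disjoint union of a star with `s` leaves and
`r` isolated vertices. -/
abbrev starUnionIsolated (s r : ℕ) : SimpleGraph ((Fin 1 ⊕ Fin s) ⊕ Fin r) :=
  completeBipartiteGraph (Fin 1) (Fin s) ⊕g (⊥ : SimpleGraph (Fin r))

/-- The second largest eigenvalue, counted with multiplicity, of the Laplacian matrix `D - A` of
a finite simple graph with at least two vertices. (`eigenvalues₀` lists the eigenvalues
in nonincreasing order, starting at index `0`.) -/
noncomputable def laplacianSecond {V : Type*} [Fintype V] [DecidableEq V]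
    (G : SimpleGraph V) [DecidableRel G.Adj] (hV : 1 < Fintype.card V) : ℝ :=
  (G.isHermitian_lapMatrix ℝ).eigenvalues₀ ⟨1, hV⟩

/-! Write `d = 2m/n` for the average degree and `μ₂` for the second eigenvalue. By Courant–Fischer,
`μ₂` is bounded below by exhibiting a two-dimensional space on which the Rayleigh quotient is large,
and above by exhibiting a hyperplane on which it is small. The proof splits on the number of
vertices of degree above `d`.

None: the graph is regular. Pencils supported on a triangle or on two disjoint edges give `μ₂ > d`
unless the graph is empty or balanced complete bipartite (`exists_parts_of_isRegular`).

At least two: `μ₂` is at least the smaller of their degrees, except for one edge with isolated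
vertices, which is excluded (`exists_iso_of_laplacianSecond_lt`).

Exactly one, `v`: put `k = ⌊d⌋`. For `k = 1` an edge avoiding `v` gives `μ₂ > d`; otherwise the
graph is a star with isolated vertices, where `μ₂ = 1`. For `k ≥ 2`, if `μ₂ ≤ d` then pencils
through `v` restrict where degrees `k` and `k - 1` can occur so severely that double counting gives
a contradiction (`not_independent_full_neighbors`). -/

open Matrix

/-! ### Courant–Fischer for the second eigenvalue. -/

section Spectral

variable {E : Type*} [NormedAddCommGroup E] [InnerProductSpace ℝ E]

theorem LinearMap.IsSymmetric.inner_apply_self_eq_sum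
    [FiniteDimensional ℝ E] {T : E →ₗ[ℝ] E} (hT : T.IsSymmetric) {N : ℕ}
    (hN : Module.finrank ℝ E = N) (x : E) :
    inner ℝ x (T x) = ∑ i, hT.eigenvalues hN i * inner ℝ (hT.eigenvectorBasis hN i) x ^ 2 := by
  rw [← (hT.eigenvectorBasis hN).sum_inner_mul_inner x (T x)]
  refine Finset.sum_congr rfl fun i _ => ?_
  rw [← hT, hT.apply_eigenvectorBasis, inner_smul_left, real_inner_comm x]
  simp
  ring

theorem OrthonormalBasis.inner_self_eq_sum {ι : Type*} [Fintype ι] (b : OrthonormalBasis ι ℝ E)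
    (x : E) : inner ℝ x x = ∑ i, inner ℝ (b i) x ^ 2 := by
  rw [← b.sum_inner_mul_inner x x]
  refine Finset.sum_congr rfl fun i _ => ?_
  rw [real_inner_comm x, sq]

/-- Every pencil of vectors contains one whose Rayleigh quotient is at most the second largest
eigenvalue. -/
theorem LinearMap.IsSymmetric.exists_inner_apply_self_le
    [FiniteDimensional ℝ E] {T : E →ₗ[ℝ] E} (hT : T.IsSymmetric)
    {N : ℕ} (hN : Module.finrank ℝ E = N) (h1 : 1 < N) (a b : E) :
    ∃ α β : ℝ, (α ≠ 0 ∨ β ≠ 0) ∧ inner ℝ (α • a + β • b) (T (α • a + β • b)) ≤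
      hT.eigenvalues hN ⟨1, h1⟩ * inner ℝ (α • a + β • b) (α • a + β • b) := by
  set e := hT.eigenvectorBasis hN
  set i₀ : Fin N := ⟨0, by omega⟩
  -- One linear equation in two unknowns: kill the component along the top eigenvector. The vectors
  -- are not assumed independent, so only the coefficients are known to be nonzero.
  obtain ⟨α, β, hne, h0⟩ : ∃ α β : ℝ, (α ≠ 0 ∨ β ≠ 0) ∧ inner ℝ (e i₀) (α • a + β • b) = 0 := by
    simp only [inner_add_right, inner_smul_right]
    by_cases hb : inner ℝ (e i₀) b = 0
    · exact ⟨0, 1, by simp, by simp [hb]⟩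
    · exact ⟨inner ℝ (e i₀) b, - inner ℝ (e i₀) a, Or.inl hb, by ring⟩
  refine ⟨α, β, hne, ?_⟩
  set x := α • a + β • b
  rw [hT.inner_apply_self_eq_sum hN, e.inner_self_eq_sum, Finset.mul_sum]
  refine Finset.sum_le_sum fun i _ => ?_
  by_cases hi : i = i₀
  · change _ * inner ℝ (e i) x ^ 2 ≤ _ * inner ℝ (e i) x ^ 2
    simp [hi, h0]
  · refine mul_le_mul_of_nonneg_right (hT.eigenvalues_antitone hN ?_) (sq_nonneg _)
    have : (i : ℕ) ≠ 0 := fun h => hi (Fin.ext h)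
    exact Fin.mk_le_of_le_val (by omega)

/-- Every hyperplane contains a nonzero vector whose Rayleigh quotient is at least the second
largest eigenvalue. -/
theorem LinearMap.IsSymmetric.exists_le_inner_apply_self
    [FiniteDimensional ℝ E] {T : E →ₗ[ℝ] E} (hT : T.IsSymmetric)
    {N : ℕ} (hN : Module.finrank ℝ E = N) (h1 : 1 < N) (z : E) :
    ∃ x : E, x ≠ 0 ∧ inner ℝ z x = 0 ∧
      hT.eigenvalues hN ⟨1, h1⟩ * inner ℝ x x ≤ inner ℝ x (T x) := by
  set e := hT.eigenvectorBasis hN with he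
  set i₀ : Fin N := ⟨0, by omega⟩
  set i₁ : Fin N := ⟨1, h1⟩
  have h01 : i₀ ≠ i₁ := by simp [i₀, i₁]
  obtain ⟨α, β, hne, h0⟩ : ∃ α β : ℝ, (α ≠ 0 ∨ β ≠ 0) ∧
      inner ℝ z (α • e i₀ + β • e i₁) = 0 := by
    simp only [inner_add_right, inner_smul_right]
    by_cases hb : inner ℝ z (e i₁) = 0
    · exact ⟨0, 1, by simp, by simp [hb]⟩
    · exact ⟨inner ℝ z (e i₁), - inner ℝ z (e i₀), Or.inl hb, by ring⟩
  have h00 : inner ℝ (e i₀) (e i₀) = (1 : ℝ) := by simp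
  have h11 : inner ℝ (e i₁) (e i₁) = (1 : ℝ) := by simp
  have h0' : inner ℝ (e i₀) (e i₁) = (0 : ℝ) := e.orthonormal.2 h01
  have h1' : inner ℝ (e i₁) (e i₀) = (0 : ℝ) := e.orthonormal.2 h01.symm
  have hxx : inner ℝ (α • e i₀ + β • e i₁) (α • e i₀ + β • e i₁) = α ^ 2 + β ^ 2 := by
    simp only [inner_add_right, inner_smul_right, inner_add_left, real_inner_smul_left, h00, h11,
      h0', h1']
    ring
  refine ⟨α • e i₀ + β • e i₁, fun h => ?_, h0, ?_⟩
  · rw [h] at hxx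
    simp at hxx
    rcases hne with h | h <;> nlinarith [sq_nonneg α, sq_nonneg β, sq_pos_of_ne_zero h]
  · rw [hxx, map_add, map_smul, map_smul, he, hT.apply_eigenvectorBasis,
      hT.apply_eigenvectorBasis, ← he]
    simp only [inner_add_right, inner_smul_right, inner_add_left, real_inner_smul_left, h00, h11,
      h0', h1']
    have := hT.eigenvalues_antitone hN (show i₀ ≤ i₁ from Fin.mk_le_of_le_val (by simp))
    simp
    nlinarith [sq_nonneg α, sq_nonneg β]

end Spectral

/-! ### The Laplacian quadratic form. -/

section Laplacian

variable {V : Type*} [Fintype V] [DecidableEq V] (G : SimpleGraph V) [DecidableRel G.Adj]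

theorem inner_toEuclideanLin_lapMatrix (x : EuclideanSpace ℝ V) :
    inner ℝ x (toEuclideanLin (G.lapMatrix ℝ) x) = x.ofLp ⬝ᵥ G.lapMatrix ℝ *ᵥ x.ofLp := by
  rw [EuclideanSpace.inner_eq_star_dotProduct, dotProduct_comm]
  simp

theorem exists_lapForm_le (hV : 1 < Fintype.card V) (a b : V → ℝ) :
    ∃ α β : ℝ, (α ≠ 0 ∨ β ≠ 0) ∧
      (α • a + β • b) ⬝ᵥ G.lapMatrix ℝ *ᵥ (α • a + β • b) ≤
        laplacianSecond G hV * ((α • a + β • b) ⬝ᵥ (α • a + β • b)) := by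
  obtain ⟨α, β, h, hle⟩ := (isSymmetric_toEuclideanLin_iff.mpr
    (G.isHermitian_lapMatrix ℝ)).exists_inner_apply_self_le finrank_euclideanSpace hV
    (WithLp.toLp 2 a) (WithLp.toLp 2 b)
  refine ⟨α, β, h, ?_⟩
  rw [inner_toEuclideanLin_lapMatrix, EuclideanSpace.inner_eq_star_dotProduct] at hle
  simpa using! hle

theorem exists_le_lapForm (hV : 1 < Fintype.card V) (z : V → ℝ) :
    ∃ x : V → ℝ, x ≠ 0 ∧ z ⬝ᵥ x = 0 ∧
      laplacianSecond G hV * (x ⬝ᵥ x) ≤ x ⬝ᵥ G.lapMatrix ℝ *ᵥ x := by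
  obtain ⟨x, h, h0, hle⟩ := (isSymmetric_toEuclideanLin_iff.mpr
    (G.isHermitian_lapMatrix ℝ)).exists_le_inner_apply_self finrank_euclideanSpace hV
    (WithLp.toLp 2 z)
  refine ⟨x.ofLp, by simpa using h, ?_, ?_⟩
  · rw [EuclideanSpace.inner_eq_star_dotProduct, dotProduct_comm] at h0
    simpa using! h0
  rw [inner_toEuclideanLin_lapMatrix, EuclideanSpace.inner_eq_star_dotProduct] at hle
  simpa using! hle

theorem lapForm_eq_sum (x : V → ℝ) : x ⬝ᵥ G.lapMatrix ℝ *ᵥ x =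
    (∑ i, ∑ j, if G.Adj i j then (x i - x j) ^ 2 else 0) / 2 := by
  rw [← G.lapMatrix_toLinearMap₂' ℝ x, toLinearMap₂'_apply']

theorem lapForm_eq_sub (x : V → ℝ) : x ⬝ᵥ G.lapMatrix ℝ *ᵥ x =
    ∑ i, G.degree i * x i ^ 2 - ∑ i, ∑ j ∈ G.neighborFinset i, x i * x j := by
  simp only [dotProduct, G.lapMatrix_mulVec_apply, mul_sub, Finset.sum_sub_distrib,
    Finset.mul_sum]
  congr 1
  exact Finset.sum_congr rfl fun i _ => by ring

/-- The Laplacian form dominates the contribution of the edges at two given vertices. -/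
theorem sum_neighbor_le_lapForm {u v : V} (huv : u ≠ v) (x : V → ℝ) :
    ∑ t ∈ G.neighborFinset u, (x u - x t) ^ 2 + ∑ t ∈ G.neighborFinset v, (x v - x t) ^ 2
      ≤ x ⬝ᵥ G.lapMatrix ℝ *ᵥ x + if G.Adj u v then (x u - x v) ^ 2 else 0 := by
  rw [lapForm_eq_sum]
  set g : V → V → ℝ := fun i j => if G.Adj i j then (x i - x j) ^ 2 else 0 with hg
  have hg0 : ∀ i j, 0 ≤ g i j := fun i j => by simp only [hg]; split_ifs <;> positivity
  have hgs : ∀ i j, g i j = g j i := fun i j => by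
    simp only [hg, G.adj_comm i j]; split_ifs <;> ring
  have hN : ∀ w, ∑ t ∈ G.neighborFinset w, (x w - x t) ^ 2 = ∑ t, g w t := fun w => by
    rw [← Finset.sum_filter]
    exact Finset.sum_congr (by ext; simp) fun _ _ => rfl
  rw [hN, hN]
  change _ ≤ (∑ i, ∑ j, g i j) / 2 + g u v
  -- The sum runs over ordered pairs. Rows `u` and `v` are kept whole; from every other row only the
  -- entries in columns `u` and `v` are kept, which mirror those two rows except for the edge `uv`.
  have hrow : ∀ i, i ∉ ({u, v} : Finset V) → g i u + g i v ≤ ∑ j, g i j := fun i _ => by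
    rw [← Finset.sum_pair huv]
    exact Finset.sum_le_sum_of_subset_of_nonneg (Finset.subset_univ _) fun _ _ _ => hg0 _ _
  have hsplit : ∀ f : V → ℝ, ∑ i, f i = f u + f v + ∑ i ∈ ({u, v} : Finset V)ᶜ, f i := fun f => by
    rw [← Finset.sum_add_sum_compl ({u, v} : Finset V), Finset.sum_pair huv]
  have h1 : ∑ i ∈ ({u, v} : Finset V)ᶜ, (g i u + g i v) ≤
      ∑ i ∈ ({u, v} : Finset V)ᶜ, ∑ j, g i j :=
    Finset.sum_le_sum fun i hi => hrow i (Finset.mem_compl.1 hi)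
  rw [hsplit (fun i => ∑ j, g i j)]
  have h2 : ∀ w, ∑ j, g w j = ∑ j, g j w := fun w => Finset.sum_congr rfl fun j _ => hgs _ _
  have h3 := hsplit (fun i => g i u)
  have h4 := hsplit (fun i => g i v)
  have h5 : g u u = 0 := by simp [hg]
  have h6 : g v v = 0 := by simp [hg]
  have h7 := hgs u v
  rw [Finset.sum_add_distrib] at h1
  rw [h2 u, h2 v] at *
  linarith

end Laplacian

/-! ### Pencils supported on at most four vertices. -/

section TestVectors

variable {V : Type*} [Fintype V] [DecidableEq V] (G : SimpleGraph V) [DecidableRel G.Adj]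

/-- Independence of the two vectors need not be assumed: a vanishing combination would make the
strict inequality read `0 < 0`. -/
theorem lt_laplacianSecond_of_pencil (hV : 1 < Fintype.card V) {c : ℝ} (a b : V → ℝ)
    (h : ∀ α β : ℝ, (α ≠ 0 ∨ β ≠ 0) → c * ((α • a + β • b) ⬝ᵥ (α • a + β • b)) <
      (α • a + β • b) ⬝ᵥ G.lapMatrix ℝ *ᵥ (α • a + β • b)) :
    c < laplacianSecond G hV := by
  obtain ⟨α, β, hne, hle⟩ := exists_lapForm_le G hV a b
  have h1 := (h α β hne).trans_le hle
  have h2 : 0 ≤ (α • a + β • b) ⬝ᵥ (α • a + β • b) :=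
    Finset.sum_nonneg fun i _ => mul_self_nonneg _
  exact lt_of_mul_lt_mul_right h1 h2

theorem le_laplacianSecond_of_pencil (hV : 1 < Fintype.card V) {c : ℝ} (a b : V → ℝ)
    (h : ∀ α β : ℝ, (α ≠ 0 ∨ β ≠ 0) → 0 < (α • a + β • b) ⬝ᵥ (α • a + β • b) ∧
      c * ((α • a + β • b) ⬝ᵥ (α • a + β • b)) ≤
      (α • a + β • b) ⬝ᵥ G.lapMatrix ℝ *ᵥ (α • a + β • b)) :
    c ≤ laplacianSecond G hV := by
  obtain ⟨α, β, hne, hle⟩ := exists_lapForm_le G hV a b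
  obtain ⟨h0, h1⟩ := h α β hne
  exact le_of_mul_le_mul_right (h1.trans hle) h0

theorem lapMatrix_apply_self (i : V) : G.lapMatrix ℝ i i = G.degree i := by
  simp [SimpleGraph.lapMatrix, SimpleGraph.degMatrix]

theorem lapMatrix_apply_of_ne {i j : V} (h : i ≠ j) :
    G.lapMatrix ℝ i j = - if G.Adj i j then 1 else 0 := by
  simp [SimpleGraph.lapMatrix, SimpleGraph.degMatrix, h, SimpleGraph.adjMatrix_apply]

theorem le_laplacianSecond_of_not_adj (hV : 1 < Fintype.card V) {u v : V} (huv : u ≠ v)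
    (hadj : ¬ G.Adj u v) {c : ℝ} (hu : c ≤ G.degree u) (hv : c ≤ G.degree v) :
    c ≤ laplacianSecond G hV := by
  refine le_laplacianSecond_of_pencil G hV (Pi.single u 1) (Pi.single v 1) fun α β hne => ?_
  have hvu : ¬ G.Adj v u := fun h => hadj h.symm
  simp [mulVec_add, mulVec_smul, lapMatrix_apply_self, lapMatrix_apply_of_ne, huv, huv.symm, hadj,
    hvu]
  constructor
  · rcases hne with h | h <;> have := sq_pos_of_ne_zero h <;> nlinarith
  · nlinarith [mul_self_nonneg α, mul_self_nonneg β]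

/-- Since `v` sees `a` and `b` alike, the cross term between `e_v` and `e_a - e_b` vanishes, and the
two Rayleigh quotients are `deg v` and `(deg a + deg b + 2) / 2`. -/
theorem lt_laplacianSecond_of_adj_of_adj_iff (hV : 1 < Fintype.card V) {v a b : V} (hva : v ≠ a)
    (hvb : v ≠ b) (hab : G.Adj a b) (hiff : G.Adj v a ↔ G.Adj v b) {c : ℝ} (hv : c < G.degree v)
    (hc : 2 * c < G.degree a + G.degree b + 2) : c < laplacianSecond G hV := by
  refine lt_laplacianSecond_of_pencil G hV (Pi.single v 1) (Pi.single a 1 - Pi.single b 1)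
    fun α β hne => ?_
  simp [mulVec_add, mulVec_sub, mulVec_smul, lapMatrix_apply_self, lapMatrix_apply_of_ne, hva,
    hva.symm, hvb, hvb.symm, hab, hab.symm, hab.ne, hab.ne.symm, hiff, G.adj_comm a v,
    G.adj_comm b v]
  rcases hne with h | h <;> have := mul_self_pos.2 h <;>
    nlinarith [mul_self_nonneg α, mul_self_nonneg β]

/-- On `α(e_a - e_b) + β(e_c - e_d)` the form exceeds `k` times the norm by `2α² + 2β² + 2tαβ` with
`t = [ad] + [bc] - [ac] - [bd]`. This is positive definite when `|t| < 2`; `h1` and `h2` rule out `t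
= -2` and `t = 2`. -/
theorem lt_laplacianSecond_of_two_edges (hV : 1 < Fintype.card V) {k : ℕ}
    (hreg : G.IsRegularOfDegree k) {a b c d : V} (hab : G.Adj a b) (hcd : G.Adj c d)
    (hac : a ≠ c) (had : a ≠ d) (hbc : b ≠ c) (hbd : b ≠ d)
    (h1 : ¬ (G.Adj a c ∧ G.Adj b d ∧ ¬ G.Adj a d ∧ ¬ G.Adj b c))
    (h2 : ¬ (¬ G.Adj a c ∧ ¬ G.Adj b d ∧ G.Adj a d ∧ G.Adj b c)) :
    k < laplacianSecond G hV := by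
  refine lt_laplacianSecond_of_pencil G hV (Pi.single a 1 - Pi.single b 1)
    (Pi.single c 1 - Pi.single d 1) fun α β hne => ?_
  simp [mulVec_add, mulVec_sub, mulVec_smul, lapMatrix_apply_self, lapMatrix_apply_of_ne, hac,
    hac.symm, had, had.symm, hbc, hbc.symm, hbd, hbd.symm, hab, hab.symm, hab.ne, hab.ne.symm,
    hcd, hcd.symm, hcd.ne, hcd.ne.symm, G.adj_comm c a, G.adj_comm c b, G.adj_comm d a,
    G.adj_comm d b, hreg a, hreg b, hreg c, hreg d]
  by_cases hac' : G.Adj a c <;> by_cases had' : G.Adj a d <;> by_cases hbc' : G.Adj b c <;>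
    by_cases hbd' : G.Adj b d <;> simp_all <;> rcases hne with h | h <;>
    have := mul_self_pos.2 h <;>
    nlinarith [mul_self_nonneg α, mul_self_nonneg β, mul_self_nonneg (α + β),
      mul_self_nonneg (α - β)]

/-- The Laplacian restricted to the triangle is `(k + 1)I - J`, so its Rayleigh quotient is `k + 1`
on the plane of vectors with sum zero. -/
theorem lt_laplacianSecond_of_triangle (hV : 1 < Fintype.card V) {k : ℕ}
    (hreg : G.IsRegularOfDegree k) {a b c : V} (hab : G.Adj a b) (hac : G.Adj a c)
    (hbc : G.Adj b c) : k < laplacianSecond G hV := by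
  refine lt_laplacianSecond_of_pencil G hV (Pi.single a 1 - Pi.single b 1)
    (Pi.single a 1 + Pi.single b 1 - (2 : ℝ) • Pi.single c 1) fun α β hne => ?_
  simp [mulVec_add, mulVec_sub, mulVec_smul, lapMatrix_apply_self, lapMatrix_apply_of_ne, hac,
    hac.symm, hbc, hbc.symm, hab, hab.symm, hab.ne, hab.ne.symm, hac.ne, hac.ne.symm, hbc.ne,
    hbc.ne.symm, hreg a, hreg b, hreg c]
  rcases hne with h | h <;> have := mul_self_pos.2 h <;>
    nlinarith [mul_self_nonneg α, mul_self_nonneg β]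

end TestVectors

/-! ### Pencils built from stars. -/

section StarVectors

variable {V : Type*} [Fintype V] [DecidableEq V] (G : SimpleGraph V) [DecidableRel G.Adj]

/-- Choose `s` further neighbors of each endpoint. If these sets overlap, the norm only shrinks
while the edges at `u` and `v` still count in full. The form then exceeds `s + 1` times the norm by
at least `2α²`, which can vanish, so the inequality is weak. -/
theorem le_laplacianSecond_of_adj (hV : 1 < Fintype.card V) {u v : V} (huv : G.Adj u v) {s : ℕ}
    (hs : 1 ≤ s) (hu : s + 1 ≤ G.degree u) (hv : s + 1 ≤ G.degree v) :
    (s + 1 : ℝ) ≤ laplacianSecond G hV := by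
  have hS : ∀ a b, G.Adj a b → s + 1 ≤ G.degree a →
      ∃ S ⊆ (G.neighborFinset a).erase b, S.card = s := fun a b hab ha => by
    refine Finset.exists_subset_card_eq ?_
    rw [Finset.card_erase_of_mem (by simpa using hab), SimpleGraph.card_neighborFinset_eq_degree]
    omega
  obtain ⟨S, hSN, hSc⟩ := hS u v huv hu
  obtain ⟨S', hSN', hSc'⟩ := hS v u huv.symm hv
  have hSu : ∀ t ∈ S, t ≠ u ∧ t ≠ v := fun t ht => by
    have := hSN ht
    simp only [Finset.mem_erase, SimpleGraph.mem_neighborFinset] at this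
    exact ⟨this.2.ne', this.1⟩
  have hSv : ∀ t ∈ S', t ≠ u ∧ t ≠ v := fun t ht => by
    have := hSN' ht
    simp only [Finset.mem_erase, SimpleGraph.mem_neighborFinset] at this
    exact ⟨this.1, this.2.ne'⟩
  have hs' : (1 : ℝ) ≤ s := by exact_mod_cast hs
  set y : V → ℝ := fun i => if i = u ∨ i = v then (s : ℝ) else if i ∈ S ∪ S' then -1 else 0
    with hy
  refine le_laplacianSecond_of_pencil G hV (Pi.single u 1 - Pi.single v 1) y fun α β hne => ?_
  set x : V → ℝ := α • (Pi.single u 1 - Pi.single v 1) + β • y with hx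
  have hxu : x u = α + s * β := by simp [hx, hy, huv.ne]; ring
  have hxv : x v = -α + s * β := by simp [hx, hy, huv.ne']; ring
  have hxS : ∀ t ∈ S, x t = -β := fun t ht => by
    simp [hx, hy, hSu t ht, ht]
  have hxS' : ∀ t ∈ S', x t = -β := fun t ht => by
    simp [hx, hy, hSv t ht, ht]
  have hform : ∀ a b (R : Finset V) (z : ℝ), G.Adj a b → R ⊆ (G.neighborFinset a).erase b →
      R.card = s → (∀ t ∈ R, x t = -β) → x a = z →
      (z - x b) ^ 2 + s * (z + β) ^ 2 ≤ ∑ t ∈ G.neighborFinset a, (x a - x t) ^ 2 := by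
    intro a b R z hab hR hRc hxR hz
    rw [← Finset.add_sum_erase _ _ ((G.mem_neighborFinset a b).2 hab), hz]
    have : ∑ t ∈ R, (z - x t) ^ 2 = s * (z + β) ^ 2 := by
      rw [Finset.sum_congr rfl fun t ht => by rw [hxR t ht, sub_neg_eq_add]]
      simp [hRc]
    rw [← this]
    gcongr
  have h1 := hform u v S _ huv hSN hSc hxS hxu
  have h2 := hform v u S' _ huv.symm hSN' hSc' hxS' hxv
  have h3 := sum_neighbor_le_lapForm G huv.ne x
  rw [if_pos huv] at h3
  rw [hxu, hxv] at h1 h2 h3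
  have hnorm : x ⬝ᵥ x ≤ 2 * α ^ 2 + 2 * (s : ℝ) ^ 2 * β ^ 2 + 2 * s * β ^ 2 := by
    have hle : x ⬝ᵥ x ≤ ∑ i, ((if i = u then (α + s * β) ^ 2 else 0) +
        (if i = v then (-α + s * β) ^ 2 else 0) + (if i ∈ S then β ^ 2 else 0) +
        (if i ∈ S' then β ^ 2 else 0)) := by
      refine Finset.sum_le_sum fun i _ => ?_
      rw [← sq]
      have hβ := sq_nonneg β
      by_cases hiu : i = u
      · subst hiu
        rw [hxu]
        simp only [if_true, if_neg huv.ne]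
        split_ifs <;> linarith
      by_cases hiv : i = v
      · subst hiv
        rw [hxv]
        simp only [if_true, if_neg huv.ne']
        split_ifs <;> linarith
      by_cases hiS : i ∈ S
      · rw [hxS i hiS]
        simp only [if_neg hiu, if_neg hiv, if_pos hiS]
        split_ifs <;> linarith
      by_cases hiS' : i ∈ S'
      · rw [hxS' i hiS']
        simp [hiu, hiv, hiS, hiS']
      · simp [hx, hy, hiu, hiv, hiS, hiS']
    refine hle.trans (le_of_eq ?_)
    simp [Finset.sum_add_distrib, hSc, hSc']
    ring
  constructor
  · have hpos : x u ^ 2 + x v ^ 2 ≤ x ⬝ᵥ x := by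
      rw [← Finset.sum_pair huv.ne (f := fun i => x i ^ 2), dotProduct]
      simp only [← sq]
      exact Finset.sum_le_sum_of_subset_of_nonneg (Finset.subset_univ _) fun _ _ _ => sq_nonneg _
    refine lt_of_lt_of_le ?_ hpos
    rw [hxu, hxv]
    have : (α + s * β) ^ 2 + (-α + s * β) ^ 2 = 2 * α ^ 2 + 2 * (s * β) ^ 2 := by ring
    rw [this]
    rcases hne with h | h <;> positivity
  · have h4 : (s + 1 : ℝ) * (x ⬝ᵥ x) ≤
        (s + 1) * (2 * α ^ 2 + 2 * (s : ℝ) ^ 2 * β ^ 2 + 2 * s * β ^ 2) := by gcongr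
    nlinarith [sq_nonneg α]

theorem quadratic_pos_of_discrim {A B C α β : ℝ} (hA : 0 < A) (hdisc : B ^ 2 < A * C)
    (hne : α ≠ 0 ∨ β ≠ 0) : 0 < A * α ^ 2 + 2 * B * (α * β) + C * β ^ 2 := by
  have h : A * (A * α ^ 2 + 2 * B * (α * β) + C * β ^ 2) =
      (A * α + B * β) ^ 2 + (A * C - B ^ 2) * β ^ 2 := by ring
  refine pos_of_mul_pos_right (a := A) ?_ hA.le
  rw [h]
  by_cases hβ : β = 0
  · have hα : α ≠ 0 := hne.resolve_right (not_not.2 hβ)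
    subst hβ
    have := mul_ne_zero hA.ne' hα
    simp only [mul_zero, add_zero]
    positivity
  · have := mul_pos (sub_pos.2 hdisc) (sq_pos_of_ne_zero hβ)
    positivity

/-- The discriminant condition for the pencil of `lt_laplacianSecond_of_star`, where `E = deg v - k`
and `h` counts common neighbors. Since `E(n - E) ≥ n - 1`, the worst case is `E = 1`; after that, it
is `h = k`. -/
theorem star_discrim {n k E : ℝ} {h : ℕ} (hk : 1 ≤ k) (hE : 1 ≤ E) (hn : E + k + 1 ≤ n)
    (hh : (h : ℝ) ≤ k) :
    (n * h) ^ 2 < ((n - 1) * E) * ((k ^ 2 + k) * (n - E) + n * h) := by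
  have h1 : n - 1 ≤ E * (n - E) := by nlinarith
  have h2 : (n - 1) * ((k ^ 2 + k) * (n - 1) + n * h) ≤
      ((n - 1) * E) * ((k ^ 2 + k) * (n - E) + n * h) := by
    have h0 : (0 : ℝ) ≤ n * h := mul_nonneg (by linarith) h.cast_nonneg
    have : (k ^ 2 + k) * (n - 1) ≤ (k ^ 2 + k) * (E * (n - E)) := by gcongr
    calc (n - 1) * ((k ^ 2 + k) * (n - 1) + n * h)
        ≤ (n - 1) * ((k ^ 2 + k) * (E * (n - E)) + E * (n * h)) := by
          refine mul_le_mul_of_nonneg_left ?_ (by linarith)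
          nlinarith
      _ = _ := by ring
  refine lt_of_lt_of_le ?_ h2
  rcases Nat.eq_zero_or_pos h with rfl | hpos
  · simp only [Nat.cast_zero, mul_zero, add_zero, ne_eq, OfNat.ofNat_ne_zero, not_false_eq_true,
      zero_pow]
    have : 0 < n - 1 := by linarith
    positivity
  · have hh1 : (1 : ℝ) ≤ h := by exact_mod_cast hpos
    have h3 : (n * h) * (n * h - (n - 1)) ≤ (n * k) * (n * k - (n - 1)) := by
      have : n * (h : ℝ) ≤ n * k := by gcongr; linarith
      have h5 : n ≤ n * h := by nlinarith
      refine mul_le_mul this (by linarith) (by linarith) (by linarith)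
    -- Exactly the gap between the two sides at `E = 1`, `h = k`.
    have h4 : 0 < k * (2 * n - 1) * (n - 1 - k) :=
      mul_pos (mul_pos (by linarith) (by linarith)) (by linarith)
    nlinarith

/-- A vertex of large degree together with a distant star on `k` leaves. -/
theorem lt_laplacianSecond_of_star (hV : 1 < Fintype.card V) {v c : V} (hvc : v ≠ c)
    (hadj : ¬ G.Adj v c) {k : ℕ} (hk : 1 ≤ k) (hc : G.degree c = k) (hv : k + 1 ≤ G.degree v)
    {d : ℝ} (hd : Fintype.card V * (d - k) ≤ G.degree v - k) : d < laplacianSecond G hV := by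
  set n := Fintype.card V with hn
  set Δ := G.degree v with hΔ
  set H := G.neighborFinset v ∩ G.neighborFinset c with hH
  have hHc : H.card ≤ k := by
    rw [← hc, ← SimpleGraph.card_neighborFinset_eq_degree]
    exact Finset.card_le_card Finset.inter_subset_right
  have hΔn : Δ + 2 ≤ n := by
    have h1 : G.neighborFinset v ⊆ ({v, c} : Finset V)ᶜ := fun t ht => by
      rw [SimpleGraph.mem_neighborFinset] at ht
      simp only [Finset.mem_compl, Finset.mem_insert, Finset.mem_singleton, not_or]
      exact ⟨ht.ne', fun h => hadj (h ▸ ht)⟩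
    have h2 := Finset.card_le_card h1
    rw [Finset.card_compl, Finset.card_pair hvc, SimpleGraph.card_neighborFinset_eq_degree] at h2
    omega
  have hk' : (1 : ℝ) ≤ k := by exact_mod_cast hk
  have hv' : (k : ℝ) + 1 ≤ Δ := by exact_mod_cast hv
  have hn' : (Δ : ℝ) + 1 ≤ n := by exact_mod_cast (by omega : Δ + 1 ≤ n)
  have hdisc := star_discrim (n := n) (E := Δ - k) (h := H.card) hk' (by linarith)
    (by linarith) (by exact_mod_cast hHc)
  -- The top Laplacian eigenvector of the star at `c`, with eigenvalue `k + 1`.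
  set y : V → ℝ := fun i => if i = c then (k : ℝ) else if G.Adj c i then -1 else 0 with hy
  refine lt_laplacianSecond_of_pencil G hV (Pi.single v 1) y fun α β hne => ?_
  set x : V → ℝ := α • Pi.single v 1 + β • y with hx
  have hcv : ¬ G.Adj c v := fun h => hadj h.symm
  have hxv : x v = α := by simp [hx, hy, hvc, hcv]
  have hxc : x c = k * β := by simp [hx, hy, hvc.symm]; ring
  have hxN : ∀ t, G.Adj c t → x t = -β := fun t ht => by
    have h1 : t ≠ v := fun h => hcv (h ▸ ht)
    simp [hx, hy, h1, ht.ne', ht]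
  have hx0 : ∀ t, t ≠ v → t ≠ c → ¬ G.Adj c t → x t = 0 := fun t h1 h2 h3 => by
    simp [hx, hy, h1, h2, h3]
  have hnorm : x ⬝ᵥ x = α ^ 2 + (k ^ 2 + k) * β ^ 2 := by
    have : x ⬝ᵥ x = ∑ i, ((if i = v then α ^ 2 else 0) + (if i = c then (k * β) ^ 2 else 0) +
        if i ∈ G.neighborFinset c then β ^ 2 else 0) := by
      refine Finset.sum_congr rfl fun i _ => ?_
      rw [← sq]
      by_cases h1 : i = v
      · subst h1; simp [hxv, hvc, hcv]
      by_cases h2 : i = c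
      · subst h2; simp [hxc, h1]
      by_cases h3 : G.Adj c i
      · simp [h1, h2, h3, hxN i h3]
      · simp [h1, h2, h3, hx0 i h1 h2 h3]
    rw [this]
    simp only [Finset.sum_add_distrib, Finset.sum_ite_eq', Finset.mem_univ, if_true,
      Finset.sum_ite_mem, Finset.univ_inter, Finset.sum_const,
      SimpleGraph.card_neighborFinset_eq_degree, hc, nsmul_eq_mul]
    ring
  have hsc : ∑ t ∈ G.neighborFinset c, (x c - x t) ^ 2 = k * (k + 1) ^ 2 * β ^ 2 := by
    rw [Finset.sum_congr rfl fun t ht => by rw [hxc, hxN t ((G.mem_neighborFinset c t).1 ht)]]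
    simp only [Finset.sum_const, SimpleGraph.card_neighborFinset_eq_degree, hc, nsmul_eq_mul]
    ring
  have hsv : ∑ t ∈ G.neighborFinset v, (x v - x t) ^ 2 =
      Δ * α ^ 2 + H.card * (2 * α * β + β ^ 2) := by
    have : ∀ t ∈ G.neighborFinset v, (x v - x t) ^ 2 =
        α ^ 2 + if t ∈ G.neighborFinset c then 2 * α * β + β ^ 2 else 0 := fun t ht => by
      rw [SimpleGraph.mem_neighborFinset] at ht
      by_cases h : G.Adj c t
      · simp only [hxv, hxN t h, SimpleGraph.mem_neighborFinset, h, if_true]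
        ring
      · simp [hxv, h, hx0 t ht.ne' (fun h' => hadj (h' ▸ ht)) h]
    rw [Finset.sum_congr rfl this]
    simp only [Finset.sum_add_distrib, Finset.sum_ite_mem, Finset.sum_const,
      SimpleGraph.card_neighborFinset_eq_degree, nsmul_eq_mul, ← hH, ← hΔ]
    ring
  have hform := sum_neighbor_le_lapForm G hvc x
  rw [if_neg hadj, hsc, hsv, add_zero] at hform
  -- This quadratic is `n` times the counted edge terms minus `nk + E` times the norm, and `nd ≤ nk
  -- + E` by `hd`.
  have hpos := quadratic_pos_of_discrim (mul_pos (by linarith) (by linarith)) hdisc hne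
  rw [hnorm]
  refine lt_of_lt_of_le ?_ hform
  have hn0 : (0 : ℝ) < n := by linarith
  refine lt_of_mul_lt_mul_left ?_ hn0.le
  have hN : 0 ≤ α ^ 2 + ((k : ℝ) ^ 2 + k) * β ^ 2 := by positivity
  nlinarith [mul_le_mul_of_nonneg_right hd hN]

end StarVectors

/-! ### A single vertex above the average degree, with `k ≥ 2`. -/

section UniqueMaximum

variable {V : Type*} [Fintype V] [DecidableEq V] (G : SimpleGraph V) [DecidableRel G.Adj]

theorem sum_card_neighborFinset_inter (T : Finset V) :
    ∑ c, (G.neighborFinset c ∩ T).card = ∑ t ∈ T, G.degree t := by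
  have h := Finset.sum_card_bipartiteAbove_eq_sum_card_bipartiteBelow G.Adj
    (s := Finset.univ) (t := T)
  calc ∑ c, (G.neighborFinset c ∩ T).card = ∑ c, (T.bipartiteAbove G.Adj c).card := by
        refine Finset.sum_congr rfl fun c _ => congrArg _ ?_
        ext; simp [Finset.mem_bipartiteAbove, and_comm]
    _ = ∑ t ∈ T, (Finset.univ.bipartiteBelow G.Adj t).card := h
    _ = _ := by
        refine Finset.sum_congr rfl fun t _ => ?_
        rw [← SimpleGraph.card_neighborFinset_eq_degree]
        refine congrArg _ ?_
        ext; simp [Finset.mem_bipartiteBelow, G.adj_comm]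

/-- The counting behind `lt_laplacianSecond_of_unique_max`: the full-degree neighbors of `v` have
too many edges away from `v`. -/
theorem not_independent_full_neighbors {v : V} {k e : ℕ} (hk : 2 ≤ k)
    (hle : ∀ i, i ≠ v → G.degree i ≤ k) (hsum : ∑ i, G.degree i = Fintype.card V * k + e)
    (hfar : ∀ c, c ≠ v → ¬ G.Adj v c → G.degree c ≠ k)
    (hTT : ∀ a b, G.Adj v a → G.Adj v b → G.Adj a b → G.degree a = k → G.degree b ≠ k)
    (hTP : 2 * e < Fintype.card V → ∀ a b, G.Adj v a → G.Adj v b → G.Adj a b → G.degree a = k →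
      G.degree b + 1 ≠ k) : False := by
  set T : Finset V := Finset.univ.filter fun t => G.Adj v t ∧ G.degree t = k with hT
  set n := Fintype.card V with hn
  have hmemT : ∀ t, t ∈ T ↔ G.Adj v t ∧ G.degree t = k := fun t => by simp [hT]
  have hvT : v ∉ T := fun h => G.irrefl ((hmemT v).1 h).1
  -- Edges from `T` to vertices other than `v` are counted through `f`: there are `|T|(k - 1)` of
  -- them, and none ends in `T`.
  set f : V → ℤ := fun c => ((G.neighborFinset c ∩ T).card : ℤ) with hf
  have hfv : f v = T.card := by
    simp only [hf]
    congr 2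
    refine Finset.inter_eq_right.2 fun t ht => ?_
    rw [SimpleGraph.mem_neighborFinset]
    exact ((hmemT t).1 ht).1
  have hftot : ∑ c ∈ Finset.univ.erase v, f c = T.card * ((k : ℤ) - 1) := by
    have h1 : ∑ c, f c = (T.card : ℤ) * k := by
      simp only [hf]
      rw [← Nat.cast_sum, sum_card_neighborFinset_inter,
        Finset.sum_congr rfl fun t ht => ((hmemT t).1 ht).2]
      simp
    rw [← Finset.add_sum_erase _ _ (Finset.mem_univ v), hfv] at h1
    linarith
  have hf0 : ∀ c ∈ T, f c = 0 := fun c hc => by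
    simp only [hf, Nat.cast_eq_zero, Finset.card_eq_zero, Finset.eq_empty_iff_forall_notMem,
      Finset.mem_inter, SimpleGraph.mem_neighborFinset, hmemT, not_and]
    rw [hmemT] at hc
    exact fun t hct hvt => fun h => hTT t c hvt hc.1 hct.symm h hc.2
  have hfdeg : ∀ c, f c ≤ G.degree c := fun c => by
    simp only [hf, Nat.cast_le]
    rw [← SimpleGraph.card_neighborFinset_eq_degree]
    exact Finset.card_le_card Finset.inter_subset_left
  have hfdeg' : ∀ c, G.Adj v c → f c ≤ G.degree c - 1 := fun c hc => by
    have h1 : (G.neighborFinset c ∩ T) ⊆ (G.neighborFinset c).erase v := fun t ht => by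
      rw [Finset.mem_inter] at ht
      exact Finset.mem_erase.2 ⟨fun h => hvT (h ▸ ht.2), ht.1⟩
    have h2 := Finset.card_le_card h1
    have h3 : v ∈ G.neighborFinset c := (G.mem_neighborFinset c v).2 hc.symm
    have h4 := Finset.card_pos.2 ⟨v, h3⟩
    rw [Finset.card_erase_of_mem h3] at h2
    rw [SimpleGraph.card_neighborFinset_eq_degree] at h2 h4
    simp only [hf]
    omega
  have hk' : (2 : ℤ) ≤ k := by exact_mod_cast hk
  have hle' : ∀ i, i ≠ v → (G.degree i : ℤ) ≤ k := fun i hi => by exact_mod_cast hle i hi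
  -- at most half of the vertices are full-degree neighbors of `v`
  have hcardT : T.card + ((Finset.univ.erase v).filter (· ∉ T)).card + 1 = n := by
    have h1 : (Finset.univ.erase v).filter (· ∈ T) = T := by
      ext t
      simp only [Finset.mem_filter, Finset.mem_erase, Finset.mem_univ, and_true]
      exact ⟨And.right, fun h => ⟨fun h' => hvT (h' ▸ h), h⟩⟩
    have h2 := Finset.card_filter_add_card_filter_not (s := Finset.univ.erase v) (· ∈ T)
    rw [h1, Finset.card_erase_of_mem (Finset.mem_univ v), Finset.card_univ] at h2
    have := Fintype.card_pos_iff.2 ⟨v⟩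
    omega
  have hhalf : 2 * T.card < n := by
    have h1 : ∑ c ∈ Finset.univ.erase v, f c ≤
        ∑ c ∈ Finset.univ.erase v, if c ∉ T then (k : ℤ) - 1 else 0 := by
      refine Finset.sum_le_sum fun c hc => ?_
      have hcv := Finset.ne_of_mem_erase hc
      by_cases h : c ∈ T
      · simp [h, hf0 c h]
      rw [if_pos h]
      have h2 := hle c hcv
      by_cases hvc : G.Adj v c
      · have := hfdeg' c hvc
        omega
      · have h3 := hfar c hcv hvc
        have := hfdeg c
        omega
    rw [hftot, ← Finset.sum_filter, Finset.sum_const, nsmul_eq_mul] at h1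
    have := le_of_mul_le_mul_right h1 (by linarith)
    omega
  -- The degree deficit, less the one unit forced on a neighbor of `v` outside `T`. It is
  -- nonnegative with total `|T| - k - e`, so `|T| ≥ k + e`; with `2|T| < n` this gives the
  -- hypothesis `2e < n` of `hTP`.
  set δ : V → ℤ := fun c => k - G.degree c - if G.Adj v c ∧ c ∉ T then 1 else 0 with hδ
  have hδtot : ∑ c ∈ Finset.univ.erase v, δ c = T.card - k - e := by
    simp only [hδ, Finset.sum_sub_distrib]
    have h1 : (∑ c ∈ Finset.univ.erase v, (G.degree c : ℤ)) = n * k + e - G.degree v := by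
      have : ∑ c, (G.degree c : ℤ) = n * k + e := by exact_mod_cast hsum
      rw [← Finset.add_sum_erase _ _ (Finset.mem_univ v)] at this
      linarith
    have h2 : ∑ c ∈ Finset.univ.erase v, (k : ℤ) = (n - 1) * k := by
      rw [Finset.sum_const, Finset.card_erase_of_mem (Finset.mem_univ v), Finset.card_univ,
        nsmul_eq_mul, Nat.cast_sub (Fintype.card_pos_iff.2 ⟨v⟩)]
      simp [hn]
    have h3 : (∑ c ∈ Finset.univ.erase v, if G.Adj v c ∧ c ∉ T then (1 : ℤ) else 0) =
        G.degree v - T.card := by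
      have h4 : (Finset.univ.erase v).filter (fun c => G.Adj v c ∧ c ∉ T) =
          G.neighborFinset v \ T := by
        ext t
        simp only [Finset.mem_filter, Finset.mem_erase, Finset.mem_univ, and_true,
          Finset.mem_sdiff, SimpleGraph.mem_neighborFinset]
        exact ⟨And.right, fun h => ⟨h.1.ne', h⟩⟩
      have h5 : T ⊆ G.neighborFinset v := fun t ht =>
        (G.mem_neighborFinset v t).2 ((hmemT t).1 ht).1
      rw [← Finset.sum_filter, h4, Finset.sum_const, Finset.card_sdiff_of_subset h5,
        SimpleGraph.card_neighborFinset_eq_degree, nsmul_eq_mul, mul_one, Nat.cast_sub]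
      rw [← SimpleGraph.card_neighborFinset_eq_degree]
      exact Finset.card_le_card h5
    rw [h1, h2, h3]
    ring
  have hδ0 : ∀ c ∈ Finset.univ.erase v, 0 ≤ δ c := fun c hc => by
    have hcv := Finset.ne_of_mem_erase hc
    have h1 := hle c hcv
    simp only [hδ]
    split_ifs with h
    · have : G.degree c ≠ k := fun h2 => h.2 ((hmemT c).2 ⟨h.1, h2⟩)
      omega
    · omega
  have hτ : (k : ℤ) + e ≤ T.card := by
    have := Finset.sum_nonneg hδ0
    linarith
  have hTP' := hTP (by omega)
  -- Where `δ` vanishes, so does `f`; elsewhere `δ ≥ 1` and `f ≤ k - 1`. Summing gives `|T| ≤ |T| -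
  -- k - e`, which is absurd.
  have hfδ : ∑ c ∈ Finset.univ.erase v, f c ≤ ∑ c ∈ Finset.univ.erase v, (k - 1) * δ c := by
    refine Finset.sum_le_sum fun c hc => ?_
    have hcv := Finset.ne_of_mem_erase hc
    have h1 := hle' c hcv
    by_cases hcT : c ∈ T
    · rw [hf0 c hcT]
      exact mul_nonneg (by linarith) (hδ0 c hc)
    by_cases hvc : G.Adj v c
    · have h2 : G.degree c ≠ k := fun h => hcT ((hmemT c).2 ⟨hvc, h⟩)
      have h3 : δ c = k - G.degree c - 1 := by simp [hδ, hvc, hcT]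
      rw [h3]
      by_cases h4 : G.degree c + 1 = k
      · have h5 : f c = 0 := by
          simp only [hf, Nat.cast_eq_zero, Finset.card_eq_zero,
            Finset.eq_empty_iff_forall_notMem, Finset.mem_inter, SimpleGraph.mem_neighborFinset,
            hmemT, not_and]
          exact fun t hct hvt h => hTP' t c hvt hvc hct.symm h h4
        rw [h5]
        exact mul_nonneg (by linarith) (by omega)
      · have h5 := hfdeg' c hvc
        have h6 : (G.degree c : ℤ) + 2 ≤ k := by
          have := hle c hcv
          omega
        nlinarith
    · have h2 := hfar c hcv hvc
      have h3 : δ c = k - G.degree c := by simp [hδ, hvc]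
      have h4 := hfdeg c
      have h6 : (G.degree c : ℤ) + 1 ≤ k := by
        have := hle c hcv
        omega
      rw [h3]
      nlinarith
  rw [hftot, ← Finset.mul_sum, hδtot, mul_comm] at hfδ
  have := le_of_mul_le_mul_left hfδ (by linarith)
  omega

/-- If `μ₂ ≤ d`, the star pencil forbids degree `k` at non-neighbors of `v`, and the edge pencil
forbids the edges in `hTT` (as `d < k + 1`) and in `hTP` (as `2e < n` gives `2d < 2k + 1`), so the
counting lemma applies. -/
theorem lt_laplacianSecond_of_unique_max (hV : 1 < Fintype.card V) {v : V} {k e : ℕ} (hk : 2 ≤ k)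
    (hv : k + 1 ≤ G.degree v) (hle : ∀ i, i ≠ v → G.degree i ≤ k)
    (hsum : ∑ i, G.degree i = Fintype.card V * k + e) {d : ℝ}
    (hd : Fintype.card V * (d - k) = e) : d < laplacianSecond G hV := by
  by_contra hnot
  set n := Fintype.card V with hn
  have he : e + k ≤ G.degree v := by
    have h1 : ∑ i ∈ Finset.univ.erase v, G.degree i ≤ (n - 1) * k := by
      refine (Finset.sum_le_card_nsmul _ _ k fun i hi => hle i (Finset.ne_of_mem_erase hi)).trans ?_
      rw [Finset.card_erase_of_mem (Finset.mem_univ v), Finset.card_univ, smul_eq_mul]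
    rw [← Finset.add_sum_erase _ _ (Finset.mem_univ v)] at hsum
    have h2 : (n - 1) * k + k = n * k := by
      rw [← Nat.succ_mul]
      congr 1
      omega
    omega
  have hΔ : G.degree v < n := G.degree_lt_card_verts v
  have he' : (e : ℝ) + k ≤ G.degree v := by exact_mod_cast he
  have hv' : (k : ℝ) + 1 ≤ G.degree v := by exact_mod_cast hv
  have hΔ' : (G.degree v : ℝ) + 1 ≤ n := by exact_mod_cast hΔ
  have hk' : (2 : ℝ) ≤ k := by exact_mod_cast hk
  have hdv : d < G.degree v := by
    refine lt_of_mul_lt_mul_left (a := (n : ℝ)) ?_ (by positivity)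
    nlinarith
  have hd1 : d < k + 1 := by
    refine lt_of_mul_lt_mul_left (a := (n : ℝ)) ?_ (by positivity)
    nlinarith
  refine not_independent_full_neighbors G hk hle hsum (fun c hcv hvc hc => ?_)
    (fun a b hva hvb hab ha hb => ?_) (fun hen a b hva hvb hab ha hb => ?_)
  · exact hnot (lt_laplacianSecond_of_star G hV hcv.symm hvc (by omega) hc hv (by linarith))
  · refine hnot (lt_laplacianSecond_of_adj_of_adj_iff G hV hva.ne hvb.ne hab
      (iff_of_true hva hvb) hdv ?_)
    rw [ha, hb]
    linarith
  · refine hnot (lt_laplacianSecond_of_adj_of_adj_iff G hV hva.ne hvb.ne hab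
      (iff_of_true hva hvb) hdv ?_)
    have hb' : (G.degree b : ℝ) = k - 1 := by rw [← hb]; push_cast; ring
    have hen' : 2 * (e : ℝ) < n := by exact_mod_cast hen
    rw [ha, hb']
    have : 2 * d < 2 * k + 1 := by
      refine lt_of_mul_lt_mul_left (a := (n : ℝ)) ?_ (by positivity)
      nlinarith
    linarith

end UniqueMaximum

/-! ### Recognizing the extremal graphs up to isomorphism. -/

section Recognition

variable {V : Type*} [Fintype V] [DecidableEq V] (G : SimpleGraph V)

/-- Two graphs whose adjacency is determined by vertex classes of the same sizes are isomorphic. -/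
theorem nonempty_iso_of_classes {V W ι : Type*} [Fintype V] [Fintype W] [DecidableEq ι]
    {G : SimpleGraph V} {H : SimpleGraph W} (R : ι → ι → Prop) (f : V → ι) (g : W → ι)
    (hG : ∀ x y, G.Adj x y ↔ R (f x) (f y)) (hH : ∀ x y, H.Adj x y ↔ R (g x) (g y))
    (hcard : ∀ c, Fintype.card {x // f x = c} = Fintype.card {y // g y = c}) :
    Nonempty (G ≃g H) := by
  let e : V ≃ W := Equiv.ofFiberEquiv fun c => Fintype.equivOfCardEq (hcard c)
  have he : ∀ x, g (e x) = f x := fun x => Equiv.ofFiberEquiv_map _ x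
  exact ⟨⟨e, by intro a b; rw [hG, hH, he, he]⟩⟩

theorem nonempty_iso_starUnionIsolated [DecidableRel G.Adj] {v : V} {s r : ℕ}
    (hv : ∀ x y, G.Adj x y → x = v ∨ y = v) (hs : G.degree v = s)
    (hcard : s + r + 1 = Fintype.card V) : Nonempty (G ≃g starUnionIsolated s r) := by
  let f : V → Fin 3 := fun x => if x = v then 0 else if G.Adj v x then 1 else 2
  let g : (Fin 1 ⊕ Fin s) ⊕ Fin r → Fin 3 := Sum.elim (Sum.elim (fun _ => 0) fun _ => 1) fun _ => 2
  have h0 : Fintype.card {x // f x = 0} = 1 := by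
    rw [Fintype.card_eq_one_iff]
    refine ⟨⟨v, by simp [f]⟩, fun y => Subtype.ext ?_⟩
    by_contra h
    have := y.2
    simp only [f, if_neg h] at this
    split_ifs at this <;> simp at this
  have h1 : Fintype.card {x // f x = 1} = s := by
    rw [← hs, ← SimpleGraph.card_neighborFinset_eq_degree, Fintype.card_subtype]
    congr 1
    ext x
    simp only [f, Finset.mem_filter, Finset.mem_univ, true_and, SimpleGraph.mem_neighborFinset]
    by_cases hx : x = v
    · simp [hx]
    · by_cases hvx : G.Adj v x <;> simp [hx, hvx]
  have h2 : Fintype.card {x // f x = 2} = r := by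
    have h4 : ∑ c, Fintype.card {x // f x = c} = Fintype.card V := by
      rw [← Fintype.card_sigma]
      exact Fintype.card_congr (Equiv.sigmaFiberEquiv f)
    rw [Fin.sum_univ_three, h0, h1] at h4
    omega
  refine nonempty_iso_of_classes (fun i j => (i = 0 ∧ j = 1) ∨ (i = 1 ∧ j = 0)) f g
    (fun x y => ?_) ?_ fun c => ?_
  · by_cases hx : x = v <;> by_cases hy : y = v
    · simp [f, hx, hy]
    · by_cases h : G.Adj v y <;> simp [f, hx, hy, h]
    · by_cases h : G.Adj v x <;> simp [f, hx, hy, h, G.adj_comm x v]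
    · have : ¬ G.Adj x y := fun h => (hv x y h).elim hx hy
      by_cases h : G.Adj v x <;> by_cases h' : G.Adj v y <;> simp [f, hx, hy, h, h', this]
  · rintro ((a | a) | a) ((b | b) | b) <;> simp [g]
  · fin_cases c
    · refine h0.trans ?_
      simp only [Fintype.card_subtype, Finset.card_filter]
      simp [g, -Finset.sum_boole]
    · refine h1.trans ?_
      simp only [Fintype.card_subtype, Finset.card_filter]
      simp [g, -Finset.sum_boole]
    · refine h2.trans ?_
      simp only [Fintype.card_subtype, Finset.card_filter]
      simp [g, -Finset.sum_boole]

theorem nonempty_iso_completeBipartiteGraph {k : ℕ} (A : Finset V) (hA : A.card = k)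
    (hA' : Aᶜ.card = k) (hadj : ∀ x y, G.Adj x y ↔ (x ∈ A ↔ y ∉ A)) :
    Nonempty (G ≃g completeBipartiteGraph (Fin k) (Fin k)) := by
  refine nonempty_iso_of_classes (fun i j => i = true ↔ j = false) (fun x => decide (x ∈ A))
    Sum.isLeft (fun x y => ?_) ?_ fun c => ?_
  · simp [hadj]
  · rintro (a | a) (b | b) <;> simp
  · rw [Fintype.card_subtype, Fintype.card_subtype]
    cases c
    · simp only [decide_eq_false_iff_not, Finset.card_filter, Fintype.sum_sum_type]
      rw [← Finset.card_filter, ← Finset.compl_filter, Finset.filter_univ_mem, hA']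
      simp
    · simp only [decide_eq_true_eq, Finset.card_filter, Fintype.sum_sum_type]
      rw [← Finset.card_filter, Finset.filter_univ_mem, hA]
      simp

theorem exists_parts_of_iso {k : ℕ} (φ : G ≃g completeBipartiteGraph (Fin k) (Fin k)) :
    ∃ A : Finset V, A.card = k ∧ Aᶜ.card = k ∧ ∀ x y, G.Adj x y ↔ (x ∈ A ↔ y ∉ A) := by
  have hA : (Finset.univ.filter fun x => (φ x).isLeft = true) =
      Finset.univ.image fun j => φ.symm (Sum.inl j) := by
    ext x
    simp only [Finset.mem_filter, Finset.mem_univ, true_and, Finset.mem_image,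
      Sum.isLeft_iff]
    exact exists_congr fun j => φ.toEquiv.eq_symm_apply.symm.trans eq_comm
  have hcard : (Finset.univ.image fun j => φ.symm (Sum.inl j)).card = k := by
    rw [Finset.card_image_of_injective _ fun a b h => by simpa using h]
    simp
  refine ⟨Finset.univ.filter fun x => (φ x).isLeft = true, by rw [hA, hcard], ?_, fun x y => ?_⟩
  · have h := Fintype.card_congr φ.toEquiv
    rw [Finset.card_compl, h, hA, hcard]
    simp
  · rw [← φ.map_adj_iff]
    simp only [Finset.mem_filter, Finset.mem_univ, true_and]
    generalize φ x = a
    generalize φ y = b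
    rcases a with a | a <;> rcases b with b | b <;> simp

theorem exists_center_of_iso [DecidableRel G.Adj] {s r : ℕ} (φ : G ≃g starUnionIsolated s r) :
    ∃ v, G.degree v = s ∧ ∀ x y, G.Adj x y → x = v ∨ y = v := by
  refine ⟨φ.symm (Sum.inl (Sum.inl 0)), ?_, fun x y h => ?_⟩
  · have : G.neighborFinset (φ.symm (Sum.inl (Sum.inl 0))) =
        Finset.univ.image fun j => φ.symm (Sum.inl (Sum.inr j)) := by
      ext x
      rw [SimpleGraph.mem_neighborFinset, ← φ.map_adj_iff]
      obtain ⟨y, rfl⟩ := φ.symm.surjective x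
      simp only [RelIso.apply_symm_apply, Finset.mem_image, Finset.mem_univ, true_and,
        EmbeddingLike.apply_eq_iff_eq]
      rcases y with (y | y) | y <;> simp
    rw [← SimpleGraph.card_neighborFinset_eq_degree, this,
      Finset.card_image_of_injective _ fun a b h => by simpa using h]
    simp
  · rw [← φ.map_adj_iff] at h
    obtain ⟨a, rfl⟩ := φ.symm.surjective x
    obtain ⟨b, rfl⟩ := φ.symm.surjective y
    simp only [RelIso.apply_symm_apply, EmbeddingLike.apply_eq_iff_eq] at h ⊢
    rcases a with (a | a) | a <;> rcases b with (b | b) | b <;> simp_all [Fin.fin_one_eq_zero]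

end Recognition

/-! ### Upper bounds on the extremal graphs, and the regular case. -/

section EqualityCases

variable {V : Type*} [Fintype V] [DecidableEq V] (G : SimpleGraph V) [DecidableRel G.Adj]

theorem laplacianSecond_le_of_hyperplane (hV : 1 < Fintype.card V) {c : ℝ} (z : V → ℝ)
    (h : ∀ x : V → ℝ, z ⬝ᵥ x = 0 → x ⬝ᵥ G.lapMatrix ℝ *ᵥ x ≤ c * (x ⬝ᵥ x)) :
    laplacianSecond G hV ≤ c := by
  obtain ⟨x, hx, hz, hle⟩ := exists_le_lapForm G hV z
  have h0 : 0 < x ⬝ᵥ x := (Finset.sum_nonneg fun i _ => mul_self_nonneg _).lt_of_ne fun h =>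
    hx (dotProduct_self_eq_zero.1 h.symm)
  exact le_of_mul_le_mul_right (hle.trans (h x hz)) h0

/-- On vectors vanishing at the center the form is diagonal, and every other degree is at most `1`.
-/
theorem laplacianSecond_le_one_of_center (hV : 1 < Fintype.card V) {v : V}
    (hv : ∀ x y, G.Adj x y → x = v ∨ y = v) : laplacianSecond G hV ≤ 1 := by
  refine laplacianSecond_le_of_hyperplane G hV (Pi.single v 1) fun x hx => ?_
  have hxv : x v = 0 := by simpa using hx
  rw [lapForm_eq_sub, one_mul]
  have h0 : ∑ i, ∑ j ∈ G.neighborFinset i, x i * x j = 0 :=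
    Finset.sum_eq_zero fun i _ => Finset.sum_eq_zero fun j hj => by
      rcases hv i j ((G.mem_neighborFinset i j).1 hj) with rfl | rfl <;> simp [hxv]
  rw [h0, sub_zero]
  refine Finset.sum_le_sum fun i _ => ?_
  by_cases hi : i = v
  · simp [hi, hxv]
  have h1 : G.degree i ≤ 1 := by
    rw [← SimpleGraph.card_neighborFinset_eq_degree, ← Finset.card_singleton v]
    refine Finset.card_le_card fun j hj => ?_
    rw [SimpleGraph.mem_neighborFinset] at hj
    exact Finset.mem_singleton.2 ((hv i j hj).resolve_left hi)
  have h2 : (G.degree i : ℝ) ≤ 1 := by exact_mod_cast h1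
  nlinarith [sq_nonneg (x i)]

theorem isRegularOfDegree_of_parts {k : ℕ} {A : Finset V} (hA : A.card = k) (hA' : Aᶜ.card = k)
    (hadj : ∀ x y, G.Adj x y ↔ (x ∈ A ↔ y ∉ A)) : G.IsRegularOfDegree k := fun x => by
  rw [← SimpleGraph.card_neighborFinset_eq_degree]
  by_cases hx : x ∈ A
  · rw [← hA']
    congr 1
    ext y
    simp [hadj, hx]
  · rw [← hA]
    congr 1
    ext y
    simp [hadj, hx]

/-- On the hyperplane orthogonal to the sign vector of the bipartition, the form is `k‖x‖² - 2(∑_A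
x)²`. -/
theorem laplacianSecond_le_of_parts (hV : 1 < Fintype.card V) {k : ℕ} {A : Finset V}
    (hA : A.card = k) (hA' : Aᶜ.card = k) (hadj : ∀ x y, G.Adj x y ↔ (x ∈ A ↔ y ∉ A)) :
    laplacianSecond G hV ≤ k := by
  have hreg := isRegularOfDegree_of_parts G hA hA' hadj
  refine laplacianSecond_le_of_hyperplane G hV (fun i => if i ∈ A then 1 else -1) fun x hx => ?_
  have hS : ∑ i ∈ A, x i = ∑ i ∈ Aᶜ, x i := by
    rw [dotProduct, ← Finset.sum_add_sum_compl A,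
      Finset.sum_congr rfl fun i (hi : i ∈ A) => by rw [if_pos hi, one_mul],
      Finset.sum_congr rfl fun i (hi : i ∈ Aᶜ) => by
        rw [if_neg (Finset.mem_compl.1 hi), neg_one_mul], Finset.sum_neg_distrib] at hx
    linarith
  have hN : ∀ i, ∑ j ∈ G.neighborFinset i, x i * x j = x i * ∑ j ∈ A, x j := fun i => by
    rw [← Finset.mul_sum]
    congr 1
    by_cases hi : i ∈ A
    · rw [hS]
      refine Finset.sum_congr ?_ fun _ _ => rfl
      ext y
      simp [hadj, hi]
    · refine Finset.sum_congr ?_ fun _ _ => rfl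
      ext y
      simp [hadj, hi]
  rw [lapForm_eq_sub, Finset.sum_congr rfl fun i _ => hN i, ← Finset.sum_mul,
    ← Finset.sum_add_sum_compl A, ← Finset.sum_add_sum_compl A x, ← hS,
    Finset.sum_add_sum_compl]
  have h1 : ∑ i, (G.degree i : ℝ) * x i ^ 2 = k * (x ⬝ᵥ x) := by
    rw [dotProduct, Finset.mul_sum]
    exact Finset.sum_congr rfl fun i _ => by rw [hreg i]; ring
  rw [h1]
  nlinarith [mul_self_nonneg (∑ i ∈ A, x i)]

/-- A regular graph whose second Laplacian eigenvalue does not exceed its degree is balanced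
complete bipartite. -/
theorem exists_parts_of_isRegular (hV : 1 < Fintype.card V) {k : ℕ} (hk : 1 ≤ k)
    (hreg : G.IsRegularOfDegree k) (hnot : ¬ (k : ℝ) < laplacianSecond G hV) :
    ∃ A : Finset V, A.card = k ∧ Aᶜ.card = k ∧ ∀ x y, G.Adj x y ↔ (x ∈ A ↔ y ∉ A) := by
  have hnb : ∀ x, ∃ y, G.Adj x y := fun x => by
    rw [← G.degree_pos_iff_exists_adj, hreg x]
    exact hk
  have htri : ∀ a b c, G.Adj a b → G.Adj a c → ¬ G.Adj b c := fun a b c hab hac hbc =>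
    hnot (lt_laplacianSecond_of_triangle G hV hreg hab hac hbc)
  obtain ⟨a⟩ : Nonempty V := Fintype.card_pos_iff.1 (by omega)
  obtain ⟨b, hab⟩ := hnb a
  -- If `c` misses both `a` and `b`, any edge `cd` is disjoint from `ab`, and neither exceptional
  -- pattern of two edges can occur.
  have hcover : ∀ c, G.Adj a c ∨ G.Adj b c := fun c => by
    by_contra! hc
    obtain ⟨d, hcd⟩ := hnb c
    refine hnot (lt_laplacianSecond_of_two_edges G hV hreg hab hcd ?_ ?_ ?_ ?_
      (fun h => hc.1 h.1) (fun h => hc.2 h.2.2.2))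
    · rintro rfl; exact hc.2 hab.symm
    · rintro rfl; exact hc.1 hcd.symm
    · rintro rfl; exact hc.1 hab
    · rintro rfl; exact hc.2 hcd.symm
  have hcompl : ∀ c, G.Adj b c ↔ ¬ G.Adj a c := fun c =>
    ⟨fun h h' => htri c a b h'.symm h.symm hab, (hcover c).resolve_left⟩
  have hBc : (G.neighborFinset a)ᶜ = G.neighborFinset b := by
    ext c
    simp [hcompl]
  -- Adjacent vertices have disjoint neighborhoods, each of size `k = n/2`, hence complementary
  -- ones.
  have hN : ∀ x w, G.Adj w x → ∀ y, G.Adj x y ↔ ¬ G.Adj w y := by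
    intro x w hwx
    have hsub : G.neighborFinset x ⊆ (G.neighborFinset w)ᶜ := fun y hy => by
      rw [SimpleGraph.mem_neighborFinset] at hy
      simpa using fun h => htri w x y hwx h hy
    have hcard : (G.neighborFinset w)ᶜ.card = k := by
      have h1 := congrArg Finset.card hBc
      rw [Finset.card_compl, SimpleGraph.card_neighborFinset_eq_degree,
        SimpleGraph.card_neighborFinset_eq_degree, hreg a, hreg b] at h1
      rw [Finset.card_compl, SimpleGraph.card_neighborFinset_eq_degree, hreg w, h1]
    have heq := Finset.eq_of_subset_of_card_le hsub (by
      rw [hcard, SimpleGraph.card_neighborFinset_eq_degree, hreg x])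
    intro y
    rw [← SimpleGraph.mem_neighborFinset, heq]
    simp
  refine ⟨G.neighborFinset a, hreg a, by rw [hBc]; exact hreg b, fun x y => ?_⟩
  simp only [SimpleGraph.mem_neighborFinset]
  by_cases hx : G.Adj a x
  · simp [hN x a hx y, hx]
  · rw [hN x b ((hcompl x).2 hx) y, hcompl]
    simp [hx]

end EqualityCases

/-! ### Vertices above the average degree. -/

section AverageDegree

variable {V : Type*} [Fintype V] [DecidableEq V] (G : SimpleGraph V) [DecidableRel G.Adj]

/-- The bound `2 ≤ k` leaves each endpoint of an edge `uv` a further neighbor; a lone edge shows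
that `k = 1` fails. -/
theorem le_laplacianSecond_of_two_le (hV : 1 < Fintype.card V) {u v : V} (huv : u ≠ v) {k : ℕ}
    (hk : 2 ≤ k) (hu : k ≤ G.degree u) (hv : k ≤ G.degree v) : (k : ℝ) ≤ laplacianSecond G hV := by
  by_cases hadj : G.Adj u v
  · obtain ⟨s, rfl⟩ : ∃ s, k = s + 1 := ⟨k - 1, by omega⟩
    simpa using le_laplacianSecond_of_adj G hV hadj (by omega) hu hv
  · exact le_laplacianSecond_of_not_adj G hV huv hadj (by exact_mod_cast hu) (by exact_mod_cast hv)

/-- If the graph is not a single edge with isolated vertices, then the second Laplacian eigenvalue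
is at least the minimum of any two degrees. -/
theorem exists_iso_of_laplacianSecond_lt (hV : 1 < Fintype.card V) {u v : V} (huv : u ≠ v) {k : ℕ}
    (hu : k ≤ G.degree u) (hv : k ≤ G.degree v) (hlt : laplacianSecond G hV < k) :
    Nonempty (G ≃g starUnionIsolated 1 (Fintype.card V - 2)) := by
  have h1 : ∀ x y, x ≠ y → ¬ G.Adj x y → 1 ≤ G.degree x → 1 ≤ G.degree y →
      (1 : ℝ) ≤ laplacianSecond G hV := fun x y hxy hadj hx hy =>
    le_laplacianSecond_of_not_adj G hV hxy hadj (by exact_mod_cast hx) (by exact_mod_cast hy)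
  have hadj : G.Adj u v := by
    by_contra hadj
    exact hlt.not_ge (le_laplacianSecond_of_not_adj G hV huv hadj (by exact_mod_cast hu)
      (by exact_mod_cast hv))
  have hk : k < 2 := by
    by_contra! hk
    exact hlt.not_ge (le_laplacianSecond_of_two_le G hV huv hk hu hv)
  have hk' : (k : ℝ) ≤ 1 := by exact_mod_cast (by omega : k ≤ 1)
  have hdeg : ∀ {x y}, G.Adj x y → 1 ≤ G.degree x := fun h =>
    (G.degree_pos_iff_exists_adj _).2 ⟨_, h⟩
  have hpair : ∀ x y, x ≠ y → 1 ≤ G.degree x → 1 ≤ G.degree y → G.Adj x y := by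
    intro x y hxy hx hy
    by_contra h
    exact absurd (h1 x y hxy h hx hy) (by linarith)
  have hdeg2 : ¬ (2 ≤ G.degree u ∧ 2 ≤ G.degree v) := fun h => by
    have := le_laplacianSecond_of_two_le G hV huv le_rfl h.1 h.2
    norm_num at this
    linarith
  -- Non-isolated vertices are now pairwise adjacent, so an edge avoiding the pendant vertex `a`
  -- would give it two neighbors.
  have key : ∀ a b, G.Adj a b → G.degree a = 1 →
      Nonempty (G ≃g starUnionIsolated 1 (Fintype.card V - 2)) := by
    intro a b hab ha
    refine nonempty_iso_starUnionIsolated G (v := a) (fun x y hxy => ?_) ha (by omega)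
    by_contra! h
    have hx := hpair a x h.1.symm ha.ge (hdeg hxy)
    have hy := hpair a y h.2.symm ha.ge (hdeg hxy.symm)
    obtain ⟨z, -, hz⟩ := (G.degree_eq_one_iff_existsUnique_adj).1 ha
    exact hxy.ne ((hz x hx).trans (hz y hy).symm)
  have h3 := hdeg hadj
  have h4 := hdeg hadj.symm
  rcases Nat.lt_or_ge (G.degree u) 2 with h | h
  · exact key u v hadj (by omega)
  · exact key v u hadj.symm (by omega)

/-- If `v` is the only vertex whose degree exceeds the average degree and `G` is not a star with
isolated vertices, then the second Laplacian eigenvalue exceeds the average degree. -/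
theorem center_or_lt_laplacianSecond (hV : 1 < Fintype.card V) {v : V}
    (hv : ∑ i, G.degree i < Fintype.card V * G.degree v)
    (hle : ∀ i, i ≠ v → Fintype.card V * G.degree i ≤ ∑ j, G.degree j) :
    (2 ≤ G.degree v ∧ ∀ x y, G.Adj x y → x = v ∨ y = v) ∨
      ((∑ i, G.degree i : ℕ) : ℝ) / Fintype.card V < laplacianSecond G hV := by
  set n := Fintype.card V with hn
  set S := ∑ i, G.degree i with hS
  have hn0 : 0 < n := by omega
  have hn0' : (0 : ℝ) < n := by exact_mod_cast hn0
  set k := S / n with hk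
  set e := S % n with he
  have hSke : S = n * k + e := (Nat.div_add_mod S n).symm
  have hen : e < n := Nat.mod_lt _ hn0
  have hle' : ∀ i, i ≠ v → G.degree i ≤ k := fun i hi => by
    rw [hk, Nat.le_div_iff_mul_le hn0, mul_comm]
    exact hle i hi
  have hkv : k + 1 ≤ G.degree v := by
    by_contra! h
    have : n * G.degree v ≤ n * k := Nat.mul_le_mul_left _ (by omega)
    omega
  have hd : (n : ℝ) * ((S : ℝ) / n - k) = e := by
    rw [mul_sub, mul_div_cancel₀ _ hn0'.ne', hSke]
    push_cast
    ring
  rcases Nat.lt_or_ge k 2 with hk2 | hk2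
  · have hk1 : 1 ≤ k := by
      obtain ⟨t, ht⟩ := (G.degree_pos_iff_exists_adj v).1 (k.succ_pos.trans_le hkv)
      exact ((G.degree_pos_iff_exists_adj t).2 ⟨v, ht.symm⟩).trans_le (hle' t ht.ne')
    rw [or_iff_not_imp_right]
    intro hnot
    refine ⟨by omega, fun a b hab => ?_⟩
    by_contra! h
    -- Here `k = 1`, so a neighbor of `v` has no other neighbor. An edge avoiding `v` thus has both
    -- ends nonadjacent to `v`, and its quotient is at least `2 > d`.
    have hfar : ∀ a b, G.Adj a b → a ≠ v → b ≠ v → ¬ G.Adj v a := fun a b hab ha hb hva => by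
      have h1 : 1 < G.degree a := by
        rw [← SimpleGraph.card_neighborFinset_eq_degree, Finset.one_lt_card]
        exact ⟨v, by simpa using hva.symm, b, by simpa using hab, hb.symm⟩
      have := hle' a ha
      omega
    have hda : 1 ≤ G.degree a := (G.degree_pos_iff_exists_adj a).2 ⟨b, hab⟩
    have hdb : 1 ≤ G.degree b := (G.degree_pos_iff_exists_adj b).2 ⟨a, hab.symm⟩
    have hda' : (1 : ℝ) ≤ G.degree a := by exact_mod_cast hda
    have hdb' : (1 : ℝ) ≤ G.degree b := by exact_mod_cast hdb
    refine hnot (lt_laplacianSecond_of_adj_of_adj_iff G hV h.1.symm h.2.symm hab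
      (iff_of_false (hfar a b hab h.1 h.2) (hfar b a hab.symm h.2 h.1)) ?_ ?_)
    · rw [div_lt_iff₀ hn0', mul_comm]
      exact_mod_cast hv
    · have : (S : ℝ) / n < 2 := by
        rw [div_lt_iff₀ hn0']
        have : S < 2 * n := by
          have : n * k ≤ n * 1 := Nat.mul_le_mul_left _ (by omega)
          omega
        exact_mod_cast this
      linarith
  · exact Or.inr (lt_laplacianSecond_of_unique_max G hV hk2 hkv hle' hSke hd)

theorem sum_degree_of_center {v : V} (hv : ∀ x y, G.Adj x y → x = v ∨ y = v) :
    ∑ i, G.degree i = 2 * G.degree v := by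
  rw [G.sum_degrees_eq_twice_card_edges, ← G.card_incidenceFinset_eq_degree]
  congr 2
  ext e
  induction e with
  | _ x y =>
    simp only [SimpleGraph.mem_edgeFinset, SimpleGraph.mem_edgeSet,
      SimpleGraph.mem_incidenceFinset, SimpleGraph.incidenceSet, Set.mem_ofPred_eq, Sym2.mem_iff]
    exact ⟨fun h => ⟨h, (hv x y h).imp Eq.symm Eq.symm⟩, And.left⟩

end AverageDegree

/-! ### The excluded stars and the main theorem. -/

theorem two_mul_le_of_not_le_ceil {n r : ℕ} (h : ¬ (r : ℤ) ≤ ⌈(n : ℚ) / 2⌉ - 2) :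
    n ≤ 2 * (r + 1) := by
  have h1 : ⌈(n : ℚ) / 2⌉ ≤ (r : ℤ) + 1 := by omega
  rw [Int.ceil_le, div_le_iff₀ (by norm_num)] at h1
  have h2 : (n : ℚ) ≤ ((2 * (r + 1) : ℕ) : ℚ) := by
    push_cast at h1 ⊢
    linarith
  exact_mod_cast h2

theorem theorem3p5 {V : Type*} [Fintype V] [DecidableEq V]
    (G : SimpleGraph V) [DecidableRel G.Adj] (n m : ℕ)
    (hn : Fintype.card V = n) (hn2 : 2 < n) (hm : G.edgeFinset.card = m)
    (hG : ∀ r : ℕ, ((r : ℤ) ≤ ⌈(n : ℚ) / 2⌉ - 2 ∨ r = n - 2) →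
      ¬ Nonempty (G ≃g starUnionIsolated (n - r - 1) r)) :
    2 * (m : ℝ) / n ≤ laplacianSecond G (by omega) ∧
    (laplacianSecond G (by omega) = 2 * (m : ℝ) / n ↔
      Nonempty (G ≃g (⊥ : SimpleGraph (Fin n))) ∨
      (Even n ∧ Nonempty (G ≃g completeBipartiteGraph (Fin (n / 2)) (Fin (n / 2)))) ∨
      (Even n ∧ Nonempty (G ≃g starUnionIsolated (n / 2) (n / 2 - 1)))) := by
  have hV : 1 < Fintype.card V := by omega
  subst hn
  set n := Fintype.card V with hn
  have hsum : ∑ i, G.degree i = 2 * m := by rw [G.sum_degrees_eq_twice_card_edges, hm]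
  have hn0 : (0 : ℝ) < n := by exact_mod_cast (by omega : 0 < n)
  have hne : ∀ u : V, ∃ w, w ≠ u := fun u => Fintype.exists_ne_of_one_lt_card hV u
  -- This dichotomy yields both the inequality and the necessity of the three equality cases;
  -- sufficiency then needs only upper bounds.
  have hlow : 2 * (m : ℝ) / n < laplacianSecond G hV ∨ (2 * (m : ℝ) / n ≤ laplacianSecond G hV ∧
      (Nonempty (G ≃g (⊥ : SimpleGraph (Fin n))) ∨
      (Even n ∧ Nonempty (G ≃g completeBipartiteGraph (Fin (n / 2)) (Fin (n / 2)))) ∨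
      (Even n ∧ Nonempty (G ≃g starUnionIsolated (n / 2) (n / 2 - 1))))) := by
    by_cases hall : ∀ i, n * G.degree i ≤ 2 * m
    · -- no degree exceeds the average, so the graph is regular
      have hreg : ∀ i, n * G.degree i = 2 * m := by
        have h1 : ∑ i, n * G.degree i = ∑ _i : V, 2 * m := by
          rw [← Finset.mul_sum, hsum, Finset.sum_const, Finset.card_univ, smul_eq_mul]
        intro i
        exact (Finset.sum_eq_sum_iff_of_le fun i _ => hall i).1 h1 i (Finset.mem_univ i)
      obtain ⟨a⟩ : Nonempty V := Fintype.card_pos_iff.1 (by omega)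
      obtain ⟨b, hab⟩ := hne a
      have hreg' : G.IsRegularOfDegree (G.degree a) := fun i =>
        Nat.eq_of_mul_eq_mul_left (by omega) ((hreg i).trans (hreg a).symm)
      have hd : 2 * (m : ℝ) / n = G.degree a := by
        rw [div_eq_iff hn0.ne', mul_comm (G.degree a : ℝ)]
        exact_mod_cast (hreg a).symm
      rw [hd]
      rcases Nat.eq_zero_or_pos (G.degree a) with h0 | hpos
      · have hbot : ∀ x y, ¬ G.Adj x y := fun x y h => by
          have := (G.degree_pos_iff_exists_adj x).2 ⟨y, h⟩
          rw [hreg' x] at this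
          omega
        refine Or.inr ⟨?_, Or.inl ⟨⟨Fintype.equivFin V, by simp [hbot]⟩⟩⟩
        rw [h0]
        exact le_laplacianSecond_of_not_adj G hV hab.symm (hbot _ _) (by simp) (by simp)
      · rw [or_iff_not_imp_left]
        intro hnot
        obtain ⟨A, hA, hA', hadj⟩ := exists_parts_of_isRegular G hV hpos hreg' hnot
        have hcard : n = 2 * G.degree a := by
          rw [Finset.card_compl] at hA'
          have := Finset.card_le_univ A
          omega
        have hhalf : n / 2 = G.degree a := by omega
        refine ⟨le_laplacianSecond_of_two_le G hV hab (by omega) (hreg' b).ge le_rfl,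
          Or.inr (Or.inl ⟨⟨G.degree a, by omega⟩, ?_⟩)⟩
        rw [hhalf]
        exact nonempty_iso_completeBipartiteGraph G A hA hA' hadj
    · push Not at hall
      obtain ⟨v, hv⟩ := hall
      by_cases hother : ∃ u, u ≠ v ∧ 2 * m < n * G.degree u
      · left
        obtain ⟨u, huv, hu⟩ := hother
        have hlt : 2 * (m : ℝ) / n < (min (G.degree u) (G.degree v) : ℕ) := by
          rw [div_lt_iff₀ hn0, mul_comm _ (n : ℝ)]
          rcases min_choice (G.degree u) (G.degree v) with h | h <;> rw [h] <;> exact_mod_cast ‹_›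
        refine hlt.trans_le ?_
        by_contra! hnot
        have h := exists_iso_of_laplacianSecond_lt G hV huv (min_le_left _ _) (min_le_right _ _)
          hnot
        refine hG (n - 2) (Or.inr rfl) ?_
        rwa [show n - (n - 2) - 1 = 1 by omega]
      · push Not at hother
        rw [← hsum] at hv
        rcases center_or_lt_laplacianSecond G hV hv fun i hi => by rw [hsum]; exact hother i hi with
          ⟨hdeg, hc⟩ | h
        · have hm' : m = G.degree v := by
            have := sum_degree_of_center G hc
            omega
          have hlt : G.degree v < n := G.degree_lt_card_verts v
          obtain ⟨r, hr⟩ : ∃ r, r = n - G.degree v - 1 := ⟨_, rfl⟩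
          have hiso := nonempty_iso_starUnionIsolated G hc rfl (r := r) (by omega)
          -- As `m = n - r - 1` for this star, the excluded range of `r` leaves exactly `2m ≤ n`,
          -- that is, `d ≤ 1`; two leaves give `μ₂ ≥ 1`.
          have hr2 : n ≤ 2 * (r + 1) := by
            refine two_mul_le_of_not_le_ceil fun hle => hG r (Or.inl hle) ?_
            rwa [show n - r - 1 = G.degree v by omega]
          have hone : 1 ≤ laplacianSecond G hV := by
            rw [← SimpleGraph.card_neighborFinset_eq_degree] at hdeg
            obtain ⟨x, hx, y, hy, hxy⟩ := Finset.one_lt_card.1 hdeg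
            rw [SimpleGraph.mem_neighborFinset] at hx hy
            refine le_laplacianSecond_of_not_adj G hV hxy (fun h => ?_) ?_ ?_
            · rcases hc x y h with rfl | rfl
              · exact G.irrefl hx
              · exact G.irrefl hy
            · exact_mod_cast (G.degree_pos_iff_exists_adj x).2 ⟨v, hx.symm⟩
            · exact_mod_cast (G.degree_pos_iff_exists_adj y).2 ⟨v, hy.symm⟩
          rcases Nat.lt_or_ge (2 * m) n with hmn | hmn
          · refine Or.inl (lt_of_lt_of_le ?_ hone)
            rw [div_lt_one hn0]
            exact_mod_cast hmn
          · have hmn' : n = 2 * m := by omega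
            refine Or.inr ⟨le_trans ?_ hone, Or.inr (Or.inr ⟨⟨m, by omega⟩, ?_⟩)⟩
            · rw [div_le_one hn0]
              exact_mod_cast hmn'.ge
            · rwa [show n / 2 - 1 = r by omega, show n / 2 = G.degree v by omega]
        · left
          rw [hsum] at h
          exact_mod_cast h
  refine ⟨hlow.elim le_of_lt And.left, fun h => ?_, fun h => le_antisymm ?_ ?_⟩
  · exact hlow.elim (fun h' => absurd h h'.ne') And.right
  · rcases h with ⟨⟨φ⟩⟩ | ⟨hev, ⟨φ⟩⟩ | ⟨hev, ⟨φ⟩⟩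
    · refine laplacianSecond_le_of_hyperplane G hV 0 fun x _ => ?_
      have hbot : ∀ x y, ¬ G.Adj x y := fun x y h => by
        rw [← φ.map_adj_iff] at h
        simp at h
      rw [lapForm_eq_sum]
      simp only [hbot, if_false, Finset.sum_const_zero, zero_div]
      exact mul_nonneg (by positivity) (Finset.sum_nonneg fun i _ => mul_self_nonneg _)
    · obtain ⟨A, hA, hA', hadj⟩ := exists_parts_of_iso G φ
      refine (laplacianSecond_le_of_parts G hV hA hA' hadj).trans (le_of_eq ?_)
      rw [eq_div_iff hn0.ne', mul_comm]
      have h1 : ∑ i, G.degree i = n * (n / 2) := by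
        rw [Finset.sum_congr rfl fun i _ => isRegularOfDegree_of_parts G hA hA' hadj i]
        simp [hn]
      rw [hsum] at h1
      exact_mod_cast h1.symm
    · obtain ⟨v, hdeg, hc⟩ := exists_center_of_iso G φ
      refine (laplacianSecond_le_one_of_center G hV hc).trans ?_
      rw [one_le_div hn0]
      have h1 := sum_degree_of_center G hc
      obtain ⟨j, hj⟩ := hev
      exact_mod_cast (by omega : n ≤ 2 * m)
  · exact hlow.elim le_of_lt And.left
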